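/- **Setting.** Let $H$ be a Hermitian operator on a finite-dimensional complex Hilbert space (the system) with spectral norm $\|H\|=1$. Let $U_H$ be a unitary on $(\mathbb C^2)^{\otimes a}\otimes(\text{system})$ with $U_H^2=I$ that is a $(1,a,\delta)$-block encoding of $H$, i.e. $\|H-(\langle\bar 0|\otimes I)U_H(|\bar 0\rangle\otimes I)\|\le\delta$, where $|\bar0\rangle=|0\rangle^{\otimes a}$. Put $R=(2|\bar 0\rangle\langle\bar 0|-I)\otimes I$ and $V=R\,U_H$. **Algorithms.** For $j\in\mathbb N$ let $c^{(j)}_0=2^{-j}\binom{j}{j/2}$ and $c^{(j)}_\ell=2^{1-j}\binom{j}{j/2+\ell}$ for $\ell>0$ if $j$ is even, and $c^{(j)}_\ell=2^{1-j}\binom{j}{(j+1)/2+\ell}$ for $\ell\ge 0$ if $j$ is odd. $\texttt{POW-HAM}(j,d',V,|\phi\rangle)$: if $j$ is even, pick $\ell\in\{0,\dots,\lfloor d'/2\rfloor\}$ with probability proportional to $c^{(j)}_\ell$ and apply $V^{2\ell}$ to $|\phi\rangle$; if $j$ is odd, pick $\ell\in\{0,\dots,\lfloor (d'-1)/2\rfloor\}$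 with probability proportional to $c^{(j)}_\ell$ and apply $V^{2\ell+1}$ to $|\phi\rangle$. $\texttt{EXP-HAM}(t,d',d,V,|\phi\rangle)$: pick $j\in\{0,\dots,d\}$ with probability proportional to $e^{-t}t^j/j!$, then call $\texttt{POW-HAM}(j,d',V,|\phi\rangle)$. **Lemma.** There is a universal constant $C>0$ such that the following holds. Let $\varepsilon\in(0,1)$, $t>0$, and $$d=\lceil\max\{te^2,\ln(12/\varepsilon)\}\rceil,\qquad d'=\big\lceil\sqrt{2d\ln(48/\varepsilon)}\,\big\rceil,\qquad \delta\le\frac{\varepsilon^2}{1152\,d\,\ln(48/\varepsilon)}.$$ Let $H$, $U_H$, $V$ be as above, let $\Pi$ be an orthogonal projector on the system, and let $\rho_0=|\psi_0\rangle\langle\psi_0|$ with $|\psi_0\rangle$ a unit vector of the system. Then the average $\bar\rho$ of the pure states $|\phi\rangle\langle\phi|$ prepared by $\texttt{EXP-HAM}(t,d',d,V,|\bar0\rangle|\psi_0\rangle)$ is a density matrix (positive semidefinite, of trace $1$) and satisfies $$\mathrm{Tr}[(I\otimes\Pi)\bar\rho]\;\ge\;\mathrm{Tr}\big[\Pi\,e^{-t(I-H)}\rho_0\,e^{-t(I-H)}\big]-\varepsilon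 .$$ Every run of the algorithm uses $O(\sqrt t\,\log(1/\varepsilon))$ queries to $V$: the number of queries is at most $C\sqrt t\,\ln(1/\varepsilon)$ whenever $t\ge1$ and $\varepsilon\le1/2$, and at most $C\sqrt{1+t}\,\ln(2/\varepsilon)$ for all $t>0$ and $\varepsilon\in(0,1)$. -/

import Mathlib

open scoped Matrix Kronecker ENNReal Matrix.Norms.L2Operator ComplexOrder

namespace AncillaFree

/-- Basis labels of an `a`-qubit register; the label `0` is the all-zero basis state. -/
abbrev Qubits (a : ℕ) : Type := Fin a → Fin 2

section BlockEncoding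

variable {ι : Type*} [Fintype ι] [DecidableEq ι]

/-- The top-left block `(⟨0|^{⊗a} ⊗ I) U (|0⟩^{⊗a} ⊗ I)` of an operator on ancilla ⊗ system. -/
def topLeftBlock {a : ℕ} (U : Matrix (Qubits a × ι) (Qubits a × ι) ℂ) : Matrix ι ι ℂ :=
  U.submatrix (fun i => (0, i)) (fun i => (0, i))

/-- `U` is an `(α, a, δ)`-block encoding of `H`: it is unitary on `a` ancilla qubits and the
system, and `α` times its top-left block is `δ`-close to `H` in spectral norm. -/
structure IsBlockEncoding (α : ℝ) (a : ℕ) (δ : ℝ)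
    (U : Matrix (Qubits a × ι) (Qubits a × ι) ℂ) (H : Matrix ι ι ℂ) : Prop where
  alpha_pos : 0 < α
  unitary : U ∈ Matrix.unitaryGroup (Qubits a × ι) ℂ
  close : ‖H - (α : ℂ) • topLeftBlock U‖ ≤ δ

/-- The reflection `R = (2|0̄⟩⟨0̄| - I) ⊗ I`. -/
def reflection (a : ℕ) (ι : Type*) [DecidableEq ι] :
    Matrix (Qubits a × ι) (Qubits a × ι) ℂ :=
  ((2 : ℂ) • Matrix.single (0 : Qubits a) 0 (1 : ℂ) - 1) ⊗ₖ (1 : Matrix ι ι ℂ)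

/-- The quantum walk operator `V = R · U`. -/
def walk {a : ℕ} (U : Matrix (Qubits a × ι) (Qubits a × ι) ℂ) :
    Matrix (Qubits a × ι) (Qubits a × ι) ℂ :=
  reflection a ι * U

/-- The vector `|0̄⟩ ⊗ |ψ⟩`. -/
def withZero (a : ℕ) (ψ : ι → ℂ) : Qubits a × ι → ℂ :=
  fun p => if p.1 = 0 then ψ p.2 else 0

end BlockEncoding

/-- The rank-one operator `|ψ⟩⟨ψ|`. -/
def pureState {κ : Type*} (ψ : κ → ℂ) : Matrix κ κ ℂ :=
  Matrix.vecMulVec ψ (star ψ)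

section Algorithm

/-- Weights supported on `{0, …, m}`. -/
noncomputable def cutoff (m : ℕ) (c : ℕ → ℝ) (l : ℕ) : ℝ≥0∞ :=
  if l ≤ m then ENNReal.ofReal (c l) else 0

lemma cutoff_tsum_ne_zero (m : ℕ) (c : ℕ → ℝ) (h : 0 < c 0) : ∑' l, cutoff m c l ≠ 0 := by
  intro h0
  have h1 := ENNReal.tsum_eq_zero.1 h0 0
  simp only [cutoff, Nat.zero_le, if_true, ENNReal.ofReal_eq_zero] at h1
  linarith

lemma cutoff_tsum_ne_top (m : ℕ) (c : ℕ → ℝ) : ∑' l, cutoff m c l ≠ ⊤ := by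
  rw [tsum_eq_sum (s := Finset.range (m + 1))]
  · refine ENNReal.sum_ne_top.2 fun l _ => ?_
    unfold cutoff
    split_ifs <;> simp
  · intro l hl
    have : ¬ l ≤ m := by simpa [Nat.lt_succ_iff] using hl
    simp [cutoff, this]

/-- Pick `l ∈ {0, …, m}` with probability `c l / ∑_{k ≤ m} c k` (for nonnegative weights `c`). -/
noncomputable def pick (m : ℕ) (c : ℕ → ℝ) (h : 0 < c 0) : PMF ℕ :=
  PMF.normalize (cutoff m c) (cutoff_tsum_ne_zero m c h) (cutoff_tsum_ne_top m c)

/-- The coefficient `c_l` of `T_{2l}` (for `j` even) or of `T_{2l+1}` (for `j` odd) in the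
Chebyshev expansion of the monomial `x ^ j`. -/
noncomputable def powCoeff (j l : ℕ) : ℝ :=
  if Even j then
    if l = 0 then (j.choose (j / 2) : ℝ) / 2 ^ j
    else 2 * (j.choose (j / 2 + l) : ℝ) / 2 ^ j
  else 2 * (j.choose ((j + 1) / 2 + l) : ℝ) / 2 ^ j

lemma powCoeff_zero_pos (j : ℕ) : 0 < powCoeff j 0 := by
  unfold powCoeff
  by_cases hj : Even j
  · have : 0 < j.choose (j / 2) := Nat.choose_pos (Nat.div_le_self j 2)
    simp only [hj, if_true]
    positivity
  · have : 0 < j.choose ((j + 1) / 2 + 0) := by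
      apply Nat.choose_pos
      obtain ⟨k, rfl⟩ := Nat.not_even_iff_odd.1 hj
      omega
    simp only [hj, if_false]
    positivity

/-- The Poisson weight `e^{-t} t^l / l!`. -/
noncomputable def poissonCoeff (t : ℝ) (l : ℕ) : ℝ :=
  Real.exp (-t) * t ^ l / (l.factorial : ℝ)

lemma poissonCoeff_zero_pos (t : ℝ) : 0 < poissonCoeff t 0 := by
  simp [poissonCoeff, Real.exp_pos]

variable {κ : Type*} [Fintype κ]

/-- Configuration of a run: the current pure state and the number of queries made so far. -/
@[ext]
structure Run (κ : Type*) where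
  state : κ → ℂ
  queries : ℕ

/-- One query to `V`. -/
def Run.query (V : Matrix κ κ ℂ) (r : Run κ) : Run κ :=
  ⟨V *ᵥ r.state, r.queries + 1⟩

/-- `POW-HAM(j, d', V, φ)`: pick `l` in `[0, d'/2]` (`j` even) or in `[0, (d'-1)/2]` (`j` odd)
with probability proportional to the Chebyshev coefficient `c_l`, and apply `V` to the initial
state `2l` times (`j` even) or `2l+1` times (`j` odd). -/
noncomputable def powHam (j d' : ℕ) (V : Matrix κ κ ℂ) (φ : κ → ℂ) : PMF (Run κ) :=
  if Even j then
    (pick (d' / 2) (powCoeff j) (powCoeff_zero_pos j)).map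
      fun l => (Run.query V)^[2 * l] ⟨φ, 0⟩
  else
    (pick ((d' - 1) / 2) (powCoeff j) (powCoeff_zero_pos j)).map
      fun l => (Run.query V)^[2 * l + 1] ⟨φ, 0⟩

/-- `EXP-HAM(t, d', d, V, φ)`: pick `j` in `[0, d]` with probability proportional to the Poisson
weight, then call `POW-HAM(j, d', V, φ)`. -/
noncomputable def expHam (t : ℝ) (d' d : ℕ) (V : Matrix κ κ ℂ) (φ : κ → ℂ) : PMF (Run κ) :=
  (pick d (poissonCoeff t) (poissonCoeff_zero_pos t)).bind fun j => powHam j d' V φ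

/-- The average density matrix `E[|φ⟩⟨φ|]` of the state `φ` prepared by a randomized procedure. -/
noncomputable def averageState (p : PMF (Run κ)) : Matrix κ κ ℂ :=
  ∑' r : Run κ, ((p r).toReal : ℂ) • pureState r.state

end Algorithm

/-- The Poisson truncation `d = ⌈max{t e², ln(12/ε)}⌉`. -/
noncomputable def truncation (t ε : ℝ) : ℕ :=
  ⌈max (t * Real.exp 2) (Real.log (12 / ε))⌉₊

/-- The Chebyshev truncation `d' = ⌈√(2 d ln(48/ε))⌉`. -/
noncomputable def chebTruncation (t ε : ℝ) : ℕ :=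
  ⌈√(2 * (truncation t ε : ℝ) * Real.log (48 / ε))⌉₊

end AncillaFree

/-! Write `W = |0̄⟩ ⊗ I` and `A = W† U W`. Since `U² = R² = 1`, the blocks `W† V^k W` obey the
Chebyshev recurrence at `A`, hence are `T_k(A)` (qubitization, `isChebyshevSeq_topLeftBlock_walk`).
The monomial `x^j` is a convex combination of Chebyshev polynomials and `e^{-t(1-H)}` a Poisson
mixture of the `H^j`. So if `q k` is the probability of making `k` queries, the averaged block `S =
∑ q k W† V^k W` is close to `E = e^{-t(1-H)}`: Chernoff bounds control both truncations, and
`norm_sum_expQueries_sub_exp_le` gives `‖S - E‖ ≤ ε/3`.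

No postselection is needed. With `φ = W ψ`, the trace on the left is `∑ q k ‖(I ⊗ P) V^k φ‖²`.
Projecting the ancillas on `|0̄⟩` only shrinks each term, to `‖P W† V^k W ψ‖²`
(`norm_mulVec_topLeftBlock_le`); Jensen's inequality then bounds the average below by `‖P S ψ‖²`,
and replacing `S` by `E` costs at most `ε`. No run makes more than `d'` queries. -/

namespace AncillaFree

/-! ### Monomials as convex combinations of Chebyshev polynomials -/

section ChebyshevSequences

/-- The degree of the Chebyshev polynomial with coefficient `powCoeff j l`. -/
def chebDegree (j l : ℕ) : ℕ := if Even j then 2 * l else 2 * l + 1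

variable {A : Type*} [Ring A] [Algebra ℝ A]

/-- A sequence satisfying the recurrence of the Chebyshev polynomials evaluated at `x`. -/
structure IsChebyshevSeq (x : A) (B : ℕ → A) : Prop where
  zero : B 0 = 1
  one : B 1 = x
  step : ∀ k, B (k + 2) + B k = (2 : ℝ) • (x * B (k + 1))

/-- With the convention `T_{-k} = T_k` the recurrence holds at every integer, including `0`, so the
later induction has no boundary case. -/
lemma IsChebyshevSeq.mul_natAbs {x : A} {B : ℕ → A} (h : IsChebyshevSeq x B) (z : ℤ) :
    (2 : ℝ) • (x * B z.natAbs) = B (z + 1).natAbs + B (z - 1).natAbs := by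
  have key : ∀ n : ℕ, (2 : ℝ) • (x * B n) = B (n + 1) + B ((n : ℤ) - 1).natAbs := by
    intro n
    rcases n with _ | n
    · simp [h.zero, h.one, two_smul]
    · rw [← h.step n]
      congr 2
      omega
  rcases le_total 0 z with hz | hz
  · obtain ⟨n, rfl⟩ := Int.eq_ofNat_of_zero_le hz
    exact key n
  · obtain ⟨n, hn⟩ := Int.eq_ofNat_of_zero_le (neg_nonneg.2 hz)
    obtain rfl : z = -(n : ℤ) := by omega
    have e1 : (-(n : ℤ) + 1).natAbs = ((n : ℤ) - 1).natAbs := by omega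
    have e2 : (-(n : ℤ) - 1).natAbs = n + 1 := by omega
    rw [e1, e2, Int.natAbs_neg, Int.natAbs_natCast, key, add_comm]

lemma sum_choose_succ_smul (j : ℕ) (g : ℕ → A) :
    ∑ i ∈ Finset.range (j + 2), ((j + 1).choose i : ℝ) • g i
      = ∑ i ∈ Finset.range (j + 1), (j.choose i : ℝ) • (g i + g (i + 1)) := by
  rw [Finset.sum_range_succ']
  simp only [Nat.choose_succ_succ, Nat.cast_add, add_smul, Finset.sum_add_distrib, smul_add,
    Nat.choose_zero_right, Nat.cast_one]
  have h := Finset.sum_range_succ' (fun i => (j.choose i : ℝ) • g i) (j + 1)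
  rw [Finset.sum_range_succ] at h
  simp at h
  rw [add_comm (∑ i ∈ Finset.range (j + 1), (j.choose i : ℝ) • g i), h, one_smul]
  abel

/-- Multiplication by `2x` is the sum of the two unit shifts of the index in `ℤ`; iterating it gives
binomial coefficients by Pascal's rule. -/
lemma IsChebyshevSeq.two_pow_smul_pow {x : A} {B : ℕ → A} (h : IsChebyshevSeq x B) (j : ℕ) :
    (2 : ℝ) ^ j • x ^ j
      = ∑ i ∈ Finset.range (j + 1), (j.choose i : ℝ) • B ((j : ℤ) - 2 * i).natAbs := by
  induction j with
  | zero => simp [h.zero]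
  | succ j ih =>
    have e : (2 : ℝ) ^ (j + 1) • x ^ (j + 1) = (2 : ℝ) • (x * ((2 : ℝ) ^ j • x ^ j)) := by
      rw [mul_smul_comm, smul_smul, pow_succ', pow_succ']
    rw [e, ih, sum_choose_succ_smul, Finset.mul_sum, Finset.smul_sum]
    refine Finset.sum_congr rfl fun i _ => ?_
    rw [mul_smul_comm, smul_comm, h.mul_natAbs]
    congr 4 <;> push_cast <;> ring

lemma IsChebyshevSeq.pow_eq_sum_even {x : A} {B : ℕ → A} (h : IsChebyshevSeq x B) (m : ℕ) :
    x ^ (2 * m) = ∑ l ∈ Finset.range (m + 1), powCoeff (2 * m) l • B (2 * l) := by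
  have h2 : (2 : ℝ) ^ (2 * m) ≠ 0 := by positivity
  have key := h.two_pow_smul_pow (2 * m)
  -- Fold the sum about its centre: `i` and `2m - i` give the same `T`, which doubles every
  -- coefficient except the central one. This is why `powCoeff` treats `l = 0` separately for even
  -- `j`.
  rw [show 2 * m + 1 = m + (m + 1) by ring, Finset.sum_range_add, ← Finset.sum_range_reflect,
    Finset.sum_range_succ'] at key
  refine smul_right_injective A h2 ?_
  beta_reduce
  rw [key, Finset.sum_range_succ', smul_add, Finset.smul_sum, ← add_assoc,
    ← Finset.sum_add_distrib]
  congr 1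
  · refine Finset.sum_congr rfl fun l hl => ?_
    have hl : l < m := Finset.mem_range.1 hl
    have e1 : (((2 * m : ℕ) : ℤ) - 2 * ((m - 1 - l : ℕ) : ℤ)).natAbs = 2 * (l + 1) := by omega
    have e2 : (((2 * m : ℕ) : ℤ) - 2 * ((m + (l + 1) : ℕ) : ℤ)).natAbs = 2 * (l + 1) := by omega
    have e3 : (2 * m).choose (m - 1 - l) = (2 * m).choose (m + (l + 1)) := by
      rw [← Nat.choose_symm (by omega)]; congr 1; omega
    rw [e1, e2, e3, ← add_smul, smul_smul]
    congr 1
    simp only [powCoeff, even_two_mul, if_true, Nat.add_eq_zero_iff, one_ne_zero, and_false,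
      if_false]
    rw [Nat.mul_div_cancel_left m two_pos]
    field_simp
    ring
  · have e2 : (((2 * m : ℕ) : ℤ) - 2 * ((m + 0 : ℕ) : ℤ)).natAbs = 2 * 0 := by omega
    rw [e2, smul_smul]
    congr 1
    simp only [powCoeff, even_two_mul, if_true]
    rw [Nat.mul_div_cancel_left m two_pos]
    field_simp
    simp

lemma IsChebyshevSeq.pow_eq_sum_odd {x : A} {B : ℕ → A} (h : IsChebyshevSeq x B) (m : ℕ) :
    x ^ (2 * m + 1)
      = ∑ l ∈ Finset.range (m + 1), powCoeff (2 * m + 1) l • B (2 * l + 1) := by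
  have h2 : (2 : ℝ) ^ (2 * m + 1) ≠ 0 := by positivity
  have key := h.two_pow_smul_pow (2 * m + 1)
  -- For odd degree the terms pair off completely; there is no central term.
  rw [show 2 * m + 1 + 1 = (m + 1) + (m + 1) by ring, Finset.sum_range_add,
    ← Finset.sum_range_reflect] at key
  refine smul_right_injective A h2 ?_
  beta_reduce
  rw [key, Finset.smul_sum, ← Finset.sum_add_distrib]
  refine Finset.sum_congr rfl fun l hl => ?_
  have hl : l < m + 1 := Finset.mem_range.1 hl
  have e1 : (((2 * m + 1 : ℕ) : ℤ) - 2 * ((m + 1 - 1 - l : ℕ) : ℤ)).natAbs = 2 * l + 1 := by omega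
  have e2 : (((2 * m + 1 : ℕ) : ℤ) - 2 * ((m + 1 + l : ℕ) : ℤ)).natAbs = 2 * l + 1 := by omega
  have e3 : (2 * m + 1).choose (m + 1 - 1 - l) = (2 * m + 1).choose (m + 1 + l) := by
    rw [← Nat.choose_symm (by omega)]; congr 1; omega
  rw [e1, e2, e3, ← add_smul, smul_smul]
  congr 1
  have e4 : (2 * m + 1 + 1) / 2 = m + 1 := by omega
  simp only [powCoeff, Nat.not_even_two_mul_add_one, if_false, e4]
  field_simp
  ring

lemma powCoeff_nonneg (j l : ℕ) : 0 ≤ powCoeff j l := by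
  unfold powCoeff
  split_ifs <;> positivity

lemma powCoeff_eq_zero {j l : ℕ} (h : j / 2 < l) : powCoeff j l = 0 := by
  have h2 : j.choose ((j + 1) / 2 + l) = 0 := Nat.choose_eq_zero_of_lt (by omega)
  unfold powCoeff
  rw [if_neg (by omega : l ≠ 0), h2]
  split_ifs with hj
  · obtain ⟨m, rfl⟩ := hj
    rw [Nat.choose_eq_zero_of_lt (by omega)]
    simp
  · simp

lemma IsChebyshevSeq.hasSum_pow [TopologicalSpace A] {x : A} {B : ℕ → A}
    (h : IsChebyshevSeq x B) (j : ℕ) :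
    HasSum (fun l => powCoeff j l • B (chebDegree j l)) (x ^ j) := by
  have e : x ^ j = ∑ l ∈ Finset.range (j / 2 + 1), powCoeff j l • B (chebDegree j l) := by
    obtain ⟨m, rfl | rfl⟩ := Nat.even_or_odd' j
    · rw [Nat.mul_div_cancel_left m two_pos, h.pow_eq_sum_even]
      simp [chebDegree]
    · rw [show (2 * m + 1) / 2 = m by omega, h.pow_eq_sum_odd]
      simp [chebDegree]
  rw [e]
  refine hasSum_sum_of_ne_finset_zero fun l hl => ?_
  rw [powCoeff_eq_zero (by simpa using hl), zero_smul]

/-- `T_k(1) = 1`: the expansion at `x = 1` shows that the coefficients have total mass `1`. -/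
lemma isChebyshevSeq_one : IsChebyshevSeq (1 : ℝ) (fun _ => 1) :=
  ⟨rfl, rfl, fun _ => by norm_num⟩

/-- `T_k(cosh s) = cosh(ks)`: the expansion at `cosh s` serves as the moment generating function in
the Chernoff bound. -/
lemma isChebyshevSeq_cosh (s : ℝ) :
    IsChebyshevSeq (Real.cosh s) (fun k => Real.cosh (k * s)) := by
  refine ⟨by simp, by simp, fun k => ?_⟩
  have e1 : ((k + 2 : ℕ) : ℝ) * s = ((k + 1 : ℕ) : ℝ) * s + s := by push_cast; ring
  have e2 : (k : ℝ) * s = ((k + 1 : ℕ) : ℝ) * s - s := by push_cast; ring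
  rw [e1, e2, Real.cosh_add, Real.cosh_sub, smul_eq_mul]
  ring

lemma hasSum_powCoeff (j : ℕ) : HasSum (powCoeff j) 1 := by
  simpa using isChebyshevSeq_one.hasSum_pow j

lemma hasSum_powCoeff_mul_cosh (j : ℕ) (s : ℝ) :
    HasSum (fun l => powCoeff j l * Real.cosh (chebDegree j l * s)) (Real.cosh s ^ j) := by
  simpa using (isChebyshevSeq_cosh s).hasSum_pow j

end ChebyshevSequences

/-! ### Chernoff bounds for the two truncations -/

section Tails

/-- Chernoff bound for the mass of a probability sequence that is cut off beyond `m`. -/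
lemma one_sub_sum_le_of_hasSum {c e : ℕ → ℝ} {S : ℝ} (hc : ∀ l, 0 ≤ c l) (h1 : HasSum c 1)
    (hS : HasSum (fun l => c l * e l) S) (he : ∀ l, 0 ≤ e l) (m : ℕ) (he1 : ∀ l, m < l → 1 ≤ e l) :
    1 - ∑ l ∈ Finset.range (m + 1), c l ≤ S := by
  have h2 := h1.sub (hasSum_sum_of_ne_finset_zero (s := Finset.range (m + 1))
    (f := fun l => if l ≤ m then c l else 0)
    (fun l hl => by rw [if_neg]; simpa [Nat.lt_succ_iff] using hl))
  have h3 : ∑ l ∈ Finset.range (m + 1), (if l ≤ m then c l else 0)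
      = ∑ l ∈ Finset.range (m + 1), c l :=
    Finset.sum_congr rfl fun l hl => if_pos (Nat.lt_succ_iff.1 (Finset.mem_range.1 hl))
  rw [h3] at h2
  refine hasSum_le (fun l => ?_) h2 hS
  have := hc l
  split_ifs with h
  · simpa using mul_nonneg this (he l)
  · simpa using le_mul_of_one_le_right this (he1 l (not_le.1 h))

/-- Chernoff with weight `2 e^{-Ds} cosh(ks)`, which is at least `1` for `k ≥ D` because `e^x ≤ 2
cosh x`; then `cosh s ≤ e^{s²/2}`. -/
lemma powCoeff_tail_le {j d : ℕ} (hj : j ≤ d) (hd : 0 < d) {D m : ℕ}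
    (hm : ∀ l, m < l → D ≤ chebDegree j l) :
    1 - ∑ l ∈ Finset.range (m + 1), powCoeff j l ≤ 2 * Real.exp (-(D : ℝ) ^ 2 / (2 * d)) := by
  have hd' : (0 : ℝ) < d := Nat.cast_pos.2 hd
  -- This `s` minimizes the exponent `-Ds + ds²/2`.
  set s : ℝ := D / d with hs
  have hs0 : 0 ≤ s := by positivity
  have hsum := (hasSum_powCoeff_mul_cosh j s).mul_left (2 * Real.exp (-(D * s)))
  have h := one_sub_sum_le_of_hasSum
    (e := fun l => 2 * Real.exp (-(D * s)) * Real.cosh (chebDegree j l * s))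
    (powCoeff_nonneg j) (hasSum_powCoeff j)
    (by simpa only [mul_left_comm] using hsum)
    (fun l => by have := Real.cosh_pos (chebDegree j l * s); positivity) m
    (fun l hl => ?_)
  · refine h.trans ?_
    have h1 : Real.cosh s ^ j ≤ Real.exp (s ^ 2 / 2) ^ d :=
      (pow_le_pow_left₀ (Real.cosh_pos s).le (Real.cosh_le_exp_half_sq s) j).trans
        (pow_le_pow_right₀ (Real.one_le_exp (by positivity)) hj)
    calc _ ≤ 2 * Real.exp (-(D * s)) * Real.exp (s ^ 2 / 2) ^ d := by gcongr
      _ = _ := by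
        rw [← Real.exp_nat_mul, mul_assoc, ← Real.exp_add]
        congr 2
        rw [hs]
        field_simp
        ring
  · have h1 : Real.exp (chebDegree j l * s) ≤ 2 * Real.cosh (chebDegree j l * s) := by
      rw [Real.cosh_eq]
      have := Real.exp_pos (-(chebDegree j l * s))
      linarith
    have h2 : (D : ℝ) ≤ chebDegree j l := Nat.cast_le.2 (hm l hl)
    calc (1 : ℝ) ≤ Real.exp (-(D * s)) * Real.exp (chebDegree j l * s) := by
          rw [← Real.exp_add]
          refine Real.one_le_exp ?_
          nlinarith
      _ ≤ Real.exp (-(D * s)) * (2 * Real.cosh (chebDegree j l * s)) := by gcongr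
      _ = _ := by ring

lemma poissonCoeff_nonneg {t : ℝ} (ht : 0 ≤ t) (l : ℕ) : 0 ≤ poissonCoeff t l := by
  unfold poissonCoeff
  positivity

lemma hasSum_poissonCoeff_mul_pow (t r : ℝ) :
    HasSum (fun l => poissonCoeff t l * r ^ l) (Real.exp (-t) * Real.exp (t * r)) := by
  have h := NormedSpace.expSeries_div_hasSum_exp (𝔸 := ℝ) (t * r)
  rw [← Real.exp_eq_exp_ℝ] at h
  have e : (fun l => poissonCoeff t l * r ^ l)
      = fun l => Real.exp (-t) * ((t * r) ^ l / (l.factorial : ℝ)) := by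
    funext l
    rw [poissonCoeff, mul_pow]
    ring
  rw [e]
  exact h.mul_left _

lemma hasSum_poissonCoeff (t : ℝ) : HasSum (poissonCoeff t) 1 := by
  have h := hasSum_poissonCoeff_mul_pow t 1
  simpa [← Real.exp_add] using h

/-- Chernoff with weight `e^{2(l-d)}`: the exponent `-t + te² - 2d` is at most `-d` because `te² ≤
d`. -/
lemma poissonCoeff_tail_le {t : ℝ} (ht : 0 ≤ t) {d : ℕ} (hd : t * Real.exp 2 ≤ d) :
    1 - ∑ l ∈ Finset.range (d + 1), poissonCoeff t l ≤ Real.exp (-d) := by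
  have hsum := (hasSum_poissonCoeff_mul_pow t (Real.exp 2)).mul_left (Real.exp (-(2 * d)))
  have h := one_sub_sum_le_of_hasSum
    (e := fun l => Real.exp (-(2 * d)) * Real.exp 2 ^ l)
    (poissonCoeff_nonneg ht) (hasSum_poissonCoeff t)
    (by simpa only [mul_left_comm] using hsum) (fun l => by positivity) d (fun l hl => ?_)
  · refine h.trans ?_
    rw [← Real.exp_add, ← Real.exp_add]
    exact Real.exp_le_exp.2 (by linarith)
  · have : (d : ℝ) ≤ l := Nat.cast_le.2 hl.le
    rw [← Real.exp_nat_mul, ← Real.exp_add]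
    exact Real.one_le_exp (by linarith)

end Tails

/-! ### Expectations over finitely supported distributions -/

section FiniteExpectation

variable {α β E : Type*} [AddCommGroup E] [Module ℝ E]

lemma sum_toReal_eq_one (p : PMF α) (s : Finset α) (hs : ∀ x ∉ s, p x = 0) :
    ∑ x ∈ s, (p x).toReal = 1 := by
  have h := p.tsum_coe
  rw [tsum_eq_sum hs] at h
  rw [← ENNReal.toReal_sum fun x _ => p.apply_ne_top x, h, ENNReal.toReal_one]

lemma sum_map_toReal_smul [DecidableEq β] (p : PMF α) (g : α → β) (s : Finset α) (t : Finset β)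
    (hs : ∀ x ∉ s, p x = 0) (hg : ∀ x ∈ s, g x ∈ t) (f : β → E) :
    ∑ y ∈ t, ((p.map g) y).toReal • f y = ∑ x ∈ s, (p x).toReal • f (g x) := by
  have h : ∀ y, ((p.map g) y).toReal = ∑ x ∈ s, if y = g x then (p x).toReal else 0 := by
    intro y
    rw [PMF.map_apply, tsum_eq_sum (s := s) fun x hx => by simp [hs x hx], ENNReal.toReal_sum]
    · refine Finset.sum_congr rfl fun x _ => ?_
      by_cases hy : y = g x <;> simp [hy]
    · intro x _
      split_ifs
      · exact p.apply_ne_top x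
      · simp
  simp_rw [h, Finset.sum_smul]
  rw [Finset.sum_comm]
  refine Finset.sum_congr rfl fun x hx => ?_
  simp [ite_smul, hg x hx]

lemma map_apply_eq_zero (p : PMF α) (g : α → β) (s : Finset α) (t : Finset β)
    (hs : ∀ x ∉ s, p x = 0) (hg : ∀ x ∈ s, g x ∈ t) (y : β) (hy : y ∉ t) : (p.map g) y = 0 := by
  rw [PMF.apply_eq_zero_iff, PMF.support_map]
  rintro ⟨x, hx, rfl⟩
  refine hy (hg x ?_)
  by_contra h
  exact (p.mem_support_iff x).1 hx (hs x h)

lemma sum_bind_toReal_smul (p : PMF α) (q : α → PMF β) (s : Finset α) (t : Finset β)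
    (hs : ∀ x ∉ s, p x = 0) (f : β → E) :
    ∑ y ∈ t, ((p.bind q) y).toReal • f y
      = ∑ x ∈ s, (p x).toReal • ∑ y ∈ t, (q x y).toReal • f y := by
  have h : ∀ y, ((p.bind q) y).toReal = ∑ x ∈ s, (p x).toReal * (q x y).toReal := by
    intro y
    rw [PMF.bind_apply, tsum_eq_sum (s := s) fun x hx => by simp [hs x hx], ENNReal.toReal_sum]
    · simp
    · intro x _
      exact ENNReal.mul_ne_top (p.apply_ne_top x) ((q x).apply_ne_top y)
  simp_rw [h, Finset.sum_smul, Finset.smul_sum, mul_smul]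
  exact Finset.sum_comm

lemma pick_eq_zero (m : ℕ) (c : ℕ → ℝ) (h : 0 < c 0) (l : ℕ) (hl : l ∉ Finset.range (m + 1)) :
    pick m c h l = 0 := by
  have : ¬ l ≤ m := by simpa [Nat.lt_succ_iff] using hl
  rw [pick, PMF.normalize_apply, cutoff, if_neg this, zero_mul]

lemma pick_toReal {m : ℕ} {c : ℕ → ℝ} (h : 0 < c 0) (hc : ∀ l, 0 ≤ c l) {l : ℕ}
    (hl : l ∈ Finset.range (m + 1)) :
    (pick m c h l).toReal = (∑ k ∈ Finset.range (m + 1), c k)⁻¹ * c l := by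
  have hm : ∀ k ∈ Finset.range (m + 1), cutoff m c k = ENNReal.ofReal (c k) := fun k hk =>
    if_pos (Nat.lt_succ_iff.1 (Finset.mem_range.1 hk))
  have hs : ∑' k, cutoff m c k = ENNReal.ofReal (∑ k ∈ Finset.range (m + 1), c k) := by
    rw [tsum_eq_sum (s := Finset.range (m + 1)), ENNReal.ofReal_sum_of_nonneg fun k _ => hc k]
    · exact Finset.sum_congr rfl hm
    · intro k hk
      have : ¬ k ≤ m := by simpa [Nat.lt_succ_iff] using hk
      simp [cutoff, this]
  rw [pick, PMF.normalize_apply, hs, hm l hl, ENNReal.toReal_mul, ENNReal.toReal_inv,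
    ENNReal.toReal_ofReal (hc l), ENNReal.toReal_ofReal (Finset.sum_nonneg fun k _ => hc k),
    mul_comm]

end FiniteExpectation

/-- Truncating and renormalizing a convex combination costs at most twice the mass cut off. -/
lemma norm_sum_pick_smul_sub_le {E : Type*} [NormedAddCommGroup E] [NormedSpace ℝ E]
    {c : ℕ → ℝ} (h : 0 < c 0) (hc : ∀ l, 0 ≤ c l) (h1 : HasSum c 1) {X : ℕ → E} {Y : E}
    (hX : ∀ l, ‖X l‖ ≤ 1) (hY : HasSum (fun l => c l • X l) Y) (m : ℕ) :
    ‖∑ l ∈ Finset.range (m + 1), (pick m c h l).toReal • X l - Y‖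
      ≤ 2 * (1 - ∑ l ∈ Finset.range (m + 1), c l) := by
  set s := ∑ l ∈ Finset.range (m + 1), c l with hs
  set Z := ∑ l ∈ Finset.range (m + 1), c l • X l with hZ
  have hs0 : 0 < s := Finset.sum_pos' (fun l _ => hc l) ⟨0, by simp, h⟩
  have hs1 : s ≤ 1 := sum_le_hasSum _ (fun l _ => hc l) h1
  have hcX : ∀ l, ‖c l • X l‖ ≤ c l := fun l => by
    rw [norm_smul, Real.norm_of_nonneg (hc l)]
    exact mul_le_of_le_one_right (hc l) (hX l)
  have hZs : ‖Z‖ ≤ s := norm_sum_le_of_le _ fun l _ => hcX l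
  have e1 : ∑ l ∈ Finset.range (m + 1), (pick m c h l).toReal • X l = s⁻¹ • Z := by
    rw [hZ, Finset.smul_sum]
    exact Finset.sum_congr rfl fun l hl => by rw [pick_toReal h hc hl, mul_smul]
  -- The factor two in the bound: renormalizing costs `1 - s`, and the discarded tail costs another
  -- `1 - s` in `e3`.
  have e2 : ‖s⁻¹ • Z - Z‖ ≤ 1 - s := by
    have : s⁻¹ • Z - Z = (s⁻¹ - 1) • Z := by rw [sub_smul, one_smul]
    have hi : 0 ≤ s⁻¹ - 1 := sub_nonneg.2 ((one_le_inv₀ hs0).2 hs1)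
    rw [this, norm_smul, Real.norm_of_nonneg hi]
    calc (s⁻¹ - 1) * ‖Z‖ ≤ (s⁻¹ - 1) * s := by gcongr
      _ = 1 - s := by field_simp
  have e3 : ‖Z - Y‖ ≤ 1 - s := by
    have t1 := (hasSum_nat_add_iff' (m + 1)).2 hY
    have t2 := (hasSum_nat_add_iff' (m + 1)).2 h1
    rw [norm_sub_rev]
    exact t1.norm_le_of_bounded t2 fun l => hcX _
  rw [e1]
  calc ‖s⁻¹ • Z - Y‖ = ‖(s⁻¹ • Z - Z) + (Z - Y)‖ := by congr 1; abel
    _ ≤ _ := norm_add_le _ _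
    _ ≤ _ := by linarith

/-! ### The algorithm as a random number of queries -/

section QueryDistribution

/-- Both cutoffs of POW-HAM say "at most `D` queries". At `D = 0` with `j` odd this fails: truncated
subtraction still admits `l = 0`, which makes one query. -/
lemma chebDegree_le_iff {j l D : ℕ} (hD : 0 < D) :
    chebDegree j l ≤ D ↔ l ≤ if Even j then D / 2 else (D - 1) / 2 := by
  unfold chebDegree
  split_ifs <;> omega

/-- Distribution of the number of queries made by `powHam`. -/
noncomputable def powQueries (j D : ℕ) : PMF ℕ :=
  (pick (if Even j then D / 2 else (D - 1) / 2) (powCoeff j) (powCoeff_zero_pos j)).map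
    (chebDegree j)

/-- Distribution of the number of queries made by `expHam`. -/
noncomputable def expQueries (t : ℝ) (D d : ℕ) : PMF ℕ :=
  (pick d (poissonCoeff t) (poissonCoeff_zero_pos t)).bind fun j => powQueries j D

lemma chebDegree_mem_range {j D : ℕ} (hD : 0 < D) :
    ∀ l ∈ Finset.range ((if Even j then D / 2 else (D - 1) / 2) + 1),
      chebDegree j l ∈ Finset.range (D + 1) := by
  intro l hl
  rw [Finset.mem_range, Nat.lt_succ_iff] at *
  exact (chebDegree_le_iff hD).2 hl

lemma powQueries_eq_zero {j D : ℕ} (hD : 0 < D) :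
    ∀ k ∉ Finset.range (D + 1), powQueries j D k = 0 :=
  map_apply_eq_zero _ _ _ _ (pick_eq_zero _ _ _) (chebDegree_mem_range hD)

lemma expQueries_eq_zero {t : ℝ} {D d : ℕ} (hD : 0 < D) :
    ∀ k ∉ Finset.range (D + 1), expQueries t D d k = 0 := by
  intro k hk
  simp [expQueries, PMF.bind_apply, powQueries_eq_zero hD k hk]

variable {κ : Type*} [Fintype κ]

lemma powHam_eq_map (j D : ℕ) (V : Matrix κ κ ℂ) (φ : κ → ℂ) :
    powHam j D V φ = (powQueries j D).map fun k => (Run.query V)^[k] ⟨φ, 0⟩ := by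
  unfold powHam powQueries
  rw [PMF.map_comp]
  split_ifs with h <;> congr 1 <;> funext l <;> simp [chebDegree, h]

/-- The final configuration is determined by the number of queries, so all the randomness lies in
that number. -/
lemma expHam_eq_map (t : ℝ) (D d : ℕ) (V : Matrix κ κ ℂ) (φ : κ → ℂ) :
    expHam t D d V φ = (expQueries t D d).map fun k => (Run.query V)^[k] ⟨φ, 0⟩ := by
  simp [expHam, expQueries, PMF.map_bind, powHam_eq_map]

lemma iterate_query [DecidableEq κ] (V : Matrix κ κ ℂ) (φ : κ → ℂ) (k : ℕ) :
    (Run.query V)^[k] ⟨φ, 0⟩ = ⟨(V ^ k) *ᵥ φ, k⟩ := by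
  induction k with
  | zero => simp
  | succ k ih => rw [Function.iterate_succ_apply', ih, Run.query, pow_succ', Matrix.mulVec_mulVec]

lemma averageState_expHam [DecidableEq κ] (t : ℝ) {D d : ℕ} (hD : 0 < D) (V : Matrix κ κ ℂ)
    (φ : κ → ℂ) :
    averageState (expHam t D d V φ)
      = ∑ k ∈ Finset.range (D + 1), (expQueries t D d k).toReal • pureState ((V ^ k) *ᵥ φ) := by
  classical
  rw [expHam_eq_map, averageState]
  set g : ℕ → Run κ := fun k => (Run.query V)^[k] ⟨φ, 0⟩ with hg
  have hmem : ∀ k ∈ Finset.range (D + 1), g k ∈ (Finset.range (D + 1)).image g :=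
    fun k hk => Finset.mem_image_of_mem g hk
  rw [tsum_eq_sum (s := (Finset.range (D + 1)).image g) fun r hr => by
    rw [map_apply_eq_zero _ g _ _ (expQueries_eq_zero hD) hmem r hr]; simp]
  simp_rw [Complex.coe_smul]
  rw [sum_map_toReal_smul _ g _ _ (expQueries_eq_zero hD) hmem fun r => pureState r.state]
  simp_rw [hg, iterate_query]

lemma queries_le_of_mem_support_expHam {t : ℝ} {D d : ℕ} (hD : 0 < D) (V : Matrix κ κ ℂ)
    (φ : κ → ℂ) {r : Run κ} (hr : r ∈ (expHam t D d V φ).support) : r.queries ≤ D := by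
  classical
  rw [expHam_eq_map, PMF.support_map] at hr
  obtain ⟨k, hk, rfl⟩ := hr
  simp only [iterate_query]
  by_contra h
  exact (PMF.mem_support_iff _ _).1 hk
    (expQueries_eq_zero hD k (by simpa [Nat.lt_succ_iff] using h))

lemma sum_expQueries_smul {E : Type*} [AddCommGroup E] [Module ℝ E] (t : ℝ) {D d : ℕ}
    (hD : 0 < D) (f : ℕ → E) :
    ∑ k ∈ Finset.range (D + 1), (expQueries t D d k).toReal • f k
      = ∑ j ∈ Finset.range (d + 1),
          (pick d (poissonCoeff t) (poissonCoeff_zero_pos t) j).toReal •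
          ∑ l ∈ Finset.range ((if Even j then D / 2 else (D - 1) / 2) + 1),
            (pick (if Even j then D / 2 else (D - 1) / 2) (powCoeff j)
              (powCoeff_zero_pos j) l).toReal • f (chebDegree j l) := by
  rw [expQueries, sum_bind_toReal_smul _ _ _ _ (pick_eq_zero _ _ _)]
  refine Finset.sum_congr rfl fun j _ => ?_
  rw [powQueries, sum_map_toReal_smul _ _ _ _ (pick_eq_zero _ _ _) (chebDegree_mem_range hD)]

end QueryDistribution

/-! ### Qubitization -/

section Blocks

variable {ι : Type*} [Fintype ι] [DecidableEq ι] {a : ℕ}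

/-- The isometry `|0̄⟩ ⊗ I`. -/
def zeroIsometry (a : ℕ) (ι : Type*) [DecidableEq ι] : Matrix (Qubits a × ι) ι ℂ :=
  (1 : Matrix (Qubits a × ι) (Qubits a × ι) ℂ).submatrix id (fun i => (0, i))

lemma mul_zeroIsometry {κ : Type*} (M : Matrix κ (Qubits a × ι) ℂ) :
    M * zeroIsometry a ι = M.submatrix id (fun i => (0, i)) := by
  ext x i
  simp [zeroIsometry, Matrix.mul_apply, Matrix.one_apply]

lemma conjTranspose_zeroIsometry_mul {κ : Type*} (M : Matrix (Qubits a × ι) κ ℂ) :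
    (zeroIsometry a ι)ᴴ * M = M.submatrix (fun i => (0, i)) id := by
  ext i x
  simp [zeroIsometry, Matrix.mul_apply, Matrix.one_apply]

lemma topLeftBlock_eq (M : Matrix (Qubits a × ι) (Qubits a × ι) ℂ) :
    topLeftBlock M = (zeroIsometry a ι)ᴴ * M * zeroIsometry a ι := by
  rw [mul_zeroIsometry, conjTranspose_zeroIsometry_mul]
  rfl

set_option linter.unusedSectionVars false in
lemma topLeftBlock_one : topLeftBlock (1 : Matrix (Qubits a × ι) (Qubits a × ι) ℂ) = 1 := by
  ext i j
  simp [topLeftBlock, Matrix.one_apply]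

lemma conjTranspose_zeroIsometry_mul_self : (zeroIsometry a ι)ᴴ * zeroIsometry a ι = 1 := by
  have h := topLeftBlock_eq (1 : Matrix (Qubits a × ι) (Qubits a × ι) ℂ)
  rw [topLeftBlock_one, Matrix.mul_one] at h
  exact h.symm

lemma withZero_eq (ψ : ι → ℂ) : withZero a ψ = zeroIsometry a ι *ᵥ ψ := by
  ext ⟨x, i⟩
  simp [withZero, zeroIsometry, Matrix.mulVec, dotProduct, Matrix.one_apply, ite_and]

lemma reflection_eq :
    reflection a ι = (2 : ℂ) • (zeroIsometry a ι * (zeroIsometry a ι)ᴴ) - 1 := by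
  ext ⟨x, i⟩ ⟨y, j⟩
  have h : (zeroIsometry a ι * (zeroIsometry a ι)ᴴ) (x, i) (y, j)
      = if 0 = x ∧ 0 = y then (if i = j then 1 else 0) else 0 := by
    simp only [zeroIsometry, Matrix.mul_apply, Matrix.submatrix_apply, Matrix.conjTranspose_apply,
      Matrix.one_apply, id, Prod.mk.injEq]
    by_cases hx : x = 0 <;> by_cases hy : y = 0 <;> simp [hx, hy, eq_comm]
  rw [Matrix.sub_apply, Matrix.smul_apply, h]
  by_cases hij : i = j <;>
    simp [reflection, Matrix.kroneckerMap_apply, Matrix.single_apply, Matrix.one_apply, hij]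

lemma reflection_mul_self : reflection a ι * reflection a ι = 1 := by
  have h := conjTranspose_zeroIsometry_mul_self (a := a) (ι := ι)
  have h2 : (zeroIsometry a ι * (zeroIsometry a ι)ᴴ) * (zeroIsometry a ι * (zeroIsometry a ι)ᴴ)
      = zeroIsometry a ι * (zeroIsometry a ι)ᴴ := by
    rw [Matrix.mul_assoc, ← Matrix.mul_assoc _ _ (zeroIsometry a ι)ᴴ, h, Matrix.one_mul]
  rw [reflection_eq, sub_mul, mul_sub, smul_mul_smul_comm, h2, one_mul, mul_one]
  module

lemma conjTranspose_reflection : (reflection a ι)ᴴ = reflection a ι := by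
  simp [reflection_eq, Matrix.conjTranspose_mul]

lemma conjTranspose_zeroIsometry_mul_reflection :
    (zeroIsometry a ι)ᴴ * reflection a ι = (zeroIsometry a ι)ᴴ := by
  rw [reflection_eq, Matrix.mul_sub, Matrix.mul_smul, ← Matrix.mul_assoc,
    conjTranspose_zeroIsometry_mul_self, Matrix.one_mul, Matrix.mul_one]
  module

/-- Qubitization: the blocks of the powers of the walk are Chebyshev polynomials of the block. -/
lemma isChebyshevSeq_topLeftBlock_walk {U : Matrix (Qubits a × ι) (Qubits a × ι) ℂ}
    (hU : U * U = 1) :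
    IsChebyshevSeq (topLeftBlock U) (fun k => topLeftBlock (walk U ^ k)) := by
  have hW : (zeroIsometry a ι)ᴴ * walk U = (zeroIsometry a ι)ᴴ * U := by
    rw [walk, ← Matrix.mul_assoc, conjTranspose_zeroIsometry_mul_reflection]
  refine ⟨by simp [topLeftBlock_one], by simp [topLeftBlock_eq, hW], fun k => ?_⟩
  -- `U R` inverts `V = R U`, so both `V^k` and `V^{k+2}` can be written through `V^{k+1}`. As `R =
  -- 2WW† - 1`, the sum `W†U + W†UR` collapses to `2AW†`, which is the recurrence.
  have hinv : U * reflection a ι * walk U = 1 := by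
    rw [walk, Matrix.mul_assoc, ← Matrix.mul_assoc (reflection a ι), reflection_mul_self,
      Matrix.one_mul, hU]
  have e1 : (zeroIsometry a ι)ᴴ * walk U ^ (k + 2)
      = (zeroIsometry a ι)ᴴ * U * walk U ^ (k + 1) := by
    rw [pow_succ' _ (k + 1), ← Matrix.mul_assoc, hW]
  have e2 : (zeroIsometry a ι)ᴴ * walk U ^ k
      = (zeroIsometry a ι)ᴴ * (U * reflection a ι) * walk U ^ (k + 1) := by
    rw [pow_succ', Matrix.mul_assoc, ← Matrix.mul_assoc _ (walk U), hinv, Matrix.one_mul]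
  have e3 : (zeroIsometry a ι)ᴴ * (U * reflection a ι)
      = (2 : ℂ) • (topLeftBlock U * (zeroIsometry a ι)ᴴ) - (zeroIsometry a ι)ᴴ * U := by
    rw [reflection_eq, topLeftBlock_eq]
    simp only [Matrix.mul_sub, Matrix.mul_smul, Matrix.mul_one, Matrix.mul_assoc]
  rw [topLeftBlock_eq, topLeftBlock_eq, topLeftBlock_eq (walk U ^ (k + 1)), e1, e2, e3,
    Matrix.sub_mul, Matrix.sub_mul, add_sub_cancel, Matrix.smul_mul, Matrix.smul_mul]
  simp only [Matrix.mul_assoc]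
  rw [← Complex.coe_smul (2 : ℝ)]
  norm_num

lemma walk_mem_unitaryGroup {U : Matrix (Qubits a × ι) (Qubits a × ι) ℂ}
    (hU : U ∈ Matrix.unitaryGroup (Qubits a × ι) ℂ) :
    walk U ∈ Matrix.unitaryGroup (Qubits a × ι) ℂ := by
  refine mul_mem ?_ hU
  rw [Matrix.mem_unitaryGroup_iff, Matrix.star_eq_conjTranspose, conjTranspose_reflection,
    reflection_mul_self]

end Blocks

/-! ### Operator norms, pure states and the Poisson series -/

section Norms

variable {m n : Type*} [Fintype m] [Fintype n] [DecidableEq n]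

lemma norm_le_one_of_conjTranspose_mul_self {M : Matrix m n ℂ} (h : Mᴴ * M = 1) : ‖M‖ ≤ 1 := by
  have h1 := Matrix.l2_opNorm_conjTranspose_mul_self M
  have h2 : ‖(1 : Matrix n n ℂ)‖ ≤ 1 := by
    have h3 := Matrix.l2_opNorm_conjTranspose_mul_self (1 : Matrix n n ℂ)
    rw [Matrix.conjTranspose_one, Matrix.mul_one] at h3
    nlinarith [norm_nonneg (1 : Matrix n n ℂ)]
  rw [h] at h1
  nlinarith [norm_nonneg M]

/-- Only an inequality: over an empty index type the identity has norm `0`. -/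
lemma norm_one_le_one : ‖(1 : Matrix n n ℂ)‖ ≤ 1 :=
  norm_le_one_of_conjTranspose_mul_self (by simp)

lemma norm_pow_le_one {M : Matrix n n ℂ} (h : ‖M‖ ≤ 1) (k : ℕ) : ‖M ^ k‖ ≤ 1 := by
  induction k with
  | zero => simpa using norm_one_le_one
  | succ k ih =>
    rw [pow_succ]
    exact (norm_mul_le _ _).trans (mul_le_one₀ ih (norm_nonneg _) h)

lemma norm_pow_sub_pow_le {M N : Matrix n n ℂ} (hM : ‖M‖ ≤ 1) (hN : ‖N‖ ≤ 1) (k : ℕ) :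
    ‖M ^ k - N ^ k‖ ≤ k * ‖M - N‖ := by
  induction k with
  | zero => simp
  | succ k ih =>
    have e : M ^ (k + 1) - N ^ (k + 1) = M ^ k * (M - N) + (M ^ k - N ^ k) * N := by
      rw [pow_succ, pow_succ]; noncomm_ring
    rw [e]
    calc _ ≤ ‖M ^ k * (M - N)‖ + ‖(M ^ k - N ^ k) * N‖ := norm_add_le _ _
      _ ≤ ‖M ^ k‖ * ‖M - N‖ + ‖M ^ k - N ^ k‖ * ‖N‖ :=
        add_le_add (norm_mul_le _ _) (norm_mul_le _ _)
      _ ≤ 1 * ‖M - N‖ + (k * ‖M - N‖) * 1 := by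
        gcongr
        exact norm_pow_le_one hM k
      _ = _ := by push_cast; ring

lemma norm_toLp_mulVec_le {M : Matrix m n ℂ} (h : ‖M‖ ≤ 1) (v : n → ℂ) :
    ‖WithLp.toLp 2 (M *ᵥ v)‖ ≤ ‖WithLp.toLp 2 v‖ :=
  (Matrix.l2_opNorm_mulVec M (WithLp.toLp 2 v)).trans
    (mul_le_of_le_one_left (norm_nonneg _) h)

set_option linter.unusedSectionVars false in
lemma star_dotProduct_self_eq (v : n → ℂ) : star v ⬝ᵥ v = ((‖WithLp.toLp 2 v‖ ^ 2 : ℝ) : ℂ) := by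
  rw [EuclideanSpace.norm_sq_eq, dotProduct, Complex.ofReal_sum]
  refine Finset.sum_congr rfl fun i _ => ?_
  rw [Pi.star_apply, Complex.star_def, Complex.conj_mul']
  simp

set_option linter.unusedSectionVars false in
lemma trace_pureState (v : n → ℂ) : (pureState v).trace = star v ⬝ᵥ v := by
  rw [pureState, Matrix.trace_vecMulVec, dotProduct_comm]

set_option linter.unusedSectionVars false in
lemma mul_pureState_mul {Q : Matrix m n ℂ} (v : n → ℂ) :
    Q * pureState v * Qᴴ = pureState (Q *ᵥ v) := by
  rw [pureState, pureState, Matrix.mul_vecMulVec, Matrix.vecMulVec_mul, Matrix.star_mulVec]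

lemma trace_projection_mul_pureState {Q : Matrix n n ℂ} (hQ : IsStarProjection Q) (v : n → ℂ) :
    (Q * pureState v).trace.re = ‖WithLp.toLp 2 (Q *ᵥ v)‖ ^ 2 := by
  have h1 : Qᴴ = Q := hQ.isSelfAdjoint
  have h2 : Q * Q = Q := hQ.isIdempotentElem
  have h : (Q * pureState v).trace = (pureState (Q *ᵥ v)).trace := by
    rw [← mul_pureState_mul, h1, Matrix.trace_mul_comm (Q * pureState v), ← Matrix.mul_assoc, h2]
  rw [h, trace_pureState, star_dotProduct_self_eq, Complex.ofReal_re]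

lemma IsStarProjection.norm_le_one {Q : Matrix n n ℂ} (hQ : IsStarProjection Q) : ‖Q‖ ≤ 1 := by
  have h1 : Qᴴ = Q := hQ.isSelfAdjoint
  have h2 : Q * Q = Q := hQ.isIdempotentElem
  have h := Matrix.l2_opNorm_conjTranspose_mul_self Q
  rw [h1, h2] at h
  nlinarith [norm_nonneg Q]

lemma norm_topLeftBlock_le_one {a : ℕ} {M : Matrix (Qubits a × n) (Qubits a × n) ℂ}
    (h : ‖M‖ ≤ 1) : ‖topLeftBlock M‖ ≤ 1 := by
  have hW := norm_le_one_of_conjTranspose_mul_self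
    (conjTranspose_zeroIsometry_mul_self (a := a) (ι := n))
  rw [topLeftBlock_eq]
  refine (Matrix.l2_opNorm_mul _ _).trans (mul_le_one₀ ?_ (norm_nonneg _) hW)
  refine (Matrix.l2_opNorm_mul _ _).trans (mul_le_one₀ ?_ (norm_nonneg _) h)
  rwa [Matrix.l2_opNorm_conjTranspose]

lemma norm_le_one_of_mem_unitaryGroup {M : Matrix n n ℂ} (h : M ∈ Matrix.unitaryGroup n ℂ) :
    ‖M‖ ≤ 1 :=
  norm_le_one_of_conjTranspose_mul_self (Matrix.mem_unitaryGroup_iff'.1 h)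

/-- The scalar `-t` commutes with `tH`, so the exponential factors as `e^{-t} e^{tH}`. -/
lemma hasSum_poissonCoeff_smul_pow (t : ℝ) (H : Matrix n n ℂ) :
    HasSum (fun j => poissonCoeff t j • H ^ j) (NormedSpace.exp (-(t : ℂ) • (1 - H))) := by
  have h := (NormedSpace.exp_series_hasSum_exp' (𝕂 := ℝ) (t • H)).const_smul (Real.exp (-t))
  have e : NormedSpace.exp (-(t : ℂ) • (1 - H)) = Real.exp (-t) • NormedSpace.exp (t • H) := by
    have e1 : -(t : ℂ) • (1 - H) = algebraMap ℝ (Matrix n n ℂ) (-t) + t • H := by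
      rw [Algebra.algebraMap_eq_smul_one, ← Complex.ofReal_neg, Complex.coe_smul]
      module
    rw [e1, Matrix.exp_add_of_commute _ _ (Algebra.commutes (-t) (t • H)),
      ← NormedSpace.algebraMap_exp_comm, ← Real.exp_eq_exp_ℝ,
      ← Algebra.smul_def]
  rw [e]
  have e2 : (fun j => poissonCoeff t j • H ^ j)
      = fun j => Real.exp (-t) • (((j.factorial : ℝ)⁻¹) • (t • H) ^ j) := by
    funext j
    rw [poissonCoeff, smul_pow, smul_smul, smul_smul]
    congr 1
    ring
  rw [e2]
  exact h

end Norms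

/-! ### Size of the truncation parameters -/

section Parameters

variable {t ε : ℝ}

lemma log_div_pos {b : ℝ} (hb : 1 < b) (hε : 0 < ε) (hε1 : ε < 1) : 0 < Real.log (b / ε) :=
  Real.log_pos ((one_lt_div hε).2 (hε1.trans hb))

lemma mul_exp_two_le_truncation : t * Real.exp 2 ≤ truncation t ε :=
  (le_max_left _ _).trans (Nat.le_ceil _)

lemma log_le_truncation : Real.log (12 / ε) ≤ truncation t ε :=
  (le_max_right _ _).trans (Nat.le_ceil _)

lemma truncation_pos (hε : 0 < ε) (hε1 : ε < 1) : 0 < truncation t ε := by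
  have h := (log_div_pos (b := 12) (by norm_num) hε hε1).trans_le (log_le_truncation (t := t))
  exact_mod_cast h

lemma sqrt_le_chebTruncation :
    √(2 * (truncation t ε : ℝ) * Real.log (48 / ε)) ≤ chebTruncation t ε :=
  Nat.le_ceil _

lemma chebTruncation_pos (hε : 0 < ε) (hε1 : ε < 1) : 0 < chebTruncation t ε := by
  have h1 : (0 : ℝ) < truncation t ε := Nat.cast_pos.2 (truncation_pos hε hε1)
  have h2 := log_div_pos (b := 48) (by norm_num) hε hε1
  have h : (0 : ℝ) < chebTruncation t ε :=
    (Real.sqrt_pos.2 (by positivity)).trans_le sqrt_le_chebTruncation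
  exact_mod_cast h

lemma exp_neg_truncation_le (hε : 0 < ε) : Real.exp (-(truncation t ε : ℝ)) ≤ ε / 12 := by
  calc Real.exp (-(truncation t ε : ℝ)) ≤ Real.exp (-Real.log (12 / ε)) :=
        Real.exp_le_exp.2 (neg_le_neg log_le_truncation)
    _ = ε / 12 := by rw [Real.exp_neg, Real.exp_log (by positivity), inv_div]

lemma exp_neg_chebTruncation_sq_le (hε : 0 < ε) (hε1 : ε < 1) :
    Real.exp (-(chebTruncation t ε : ℝ) ^ 2 / (2 * truncation t ε)) ≤ ε / 48 := by
  have h1 : (0 : ℝ) < truncation t ε := Nat.cast_pos.2 (truncation_pos hε hε1)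
  have h2 : Real.log (48 / ε) ≤ (chebTruncation t ε : ℝ) ^ 2 / (2 * truncation t ε) := by
    rw [le_div_iff₀ (by positivity), mul_comm]
    exact (Real.sqrt_le_left (by positivity)).1 sqrt_le_chebTruncation
  calc _ ≤ Real.exp (-Real.log (48 / ε)) := Real.exp_le_exp.2 (by rw [neg_div]; linarith)
    _ = ε / 48 := by rw [Real.exp_neg, Real.exp_log (by positivity), inv_div]

lemma truncation_le (ht : 0 < t) (hε : 0 < ε) (hε1 : ε < 1) :
    (truncation t ε : ℝ) ≤ 18 * (1 + t) * Real.log (2 / ε) := by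
  have hx : Real.log 2 ≤ Real.log (2 / ε) :=
    Real.log_le_log (by norm_num) ((le_div_iff₀ hε).2 (by linarith))
  have h2 := Real.log_two_gt_d9
  have h12 : Real.log (12 / ε) ≤ 4 * Real.log (2 / ε) := by
    rw [show (12 / ε : ℝ) = 6 * (2 / ε) by ring, Real.log_mul (by norm_num) (by positivity)]
    have : Real.log 6 ≤ Real.log (2 ^ 3) := Real.log_le_log (by norm_num) (by norm_num)
    rw [Real.log_pow] at this
    push_cast at this
    linarith
  have he : Real.exp 2 ≤ 9 := by
    have h3 := Real.exp_one_lt_d9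
    rw [show (2 : ℝ) = 1 + 1 by norm_num, Real.exp_add]
    nlinarith [Real.exp_pos 1]
  -- With `x = ln(2/ε) ≥ ln 2 > 1/2`, the constant 18 suffices: `9t + 4x + 1 ≤ 18(1 + t)x`.
  have hm : max (t * Real.exp 2) (Real.log (12 / ε)) ≤ 9 * t + 4 * Real.log (2 / ε) :=
    max_le (by nlinarith) (by linarith)
  have hc := Nat.ceil_lt_add_one (a := max (t * Real.exp 2) (Real.log (12 / ε)))
    ((by positivity : 0 ≤ t * Real.exp 2).trans (le_max_left _ _))
  change (truncation t ε : ℝ) < _ at hc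
  nlinarith

lemma chebTruncation_le (ht : 0 < t) (hε : 0 < ε) (hε1 : ε < 1) :
    (chebTruncation t ε : ℝ) ≤ 30 * √(1 + t) * Real.log (2 / ε) := by
  have hx := log_div_pos (b := 2) (by norm_num) hε hε1
  have hL0 := log_div_pos (b := 48) (by norm_num) hε hε1
  have hd1 : (1 : ℝ) ≤ truncation t ε := Nat.one_le_cast.2 (truncation_pos hε hε1)
  have h2 := Real.log_two_gt_d9
  have hx2 : Real.log 2 ≤ Real.log (2 / ε) :=
    Real.log_le_log (by norm_num) ((le_div_iff₀ hε).2 (by linarith))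
  have hL : Real.log (48 / ε) ≤ 6 * Real.log (2 / ε) := by
    rw [show (48 / ε : ℝ) = 24 * (2 / ε) by ring, Real.log_mul (by norm_num) (by positivity)]
    have : Real.log 24 ≤ Real.log (2 ^ 5) := Real.log_le_log (by norm_num) (by norm_num)
    rw [Real.log_pow] at this
    push_cast at this
    linarith
  have hL1 : Real.log 2 ≤ Real.log (48 / ε) :=
    Real.log_le_log (by norm_num) ((le_div_iff₀ hε).2 (by linarith))
  -- Lets the `+1` of the ceiling be absorbed by doubling the root, turning 15 into 30.
  have hs1 : 1 ≤ √(2 * (truncation t ε : ℝ) * Real.log (48 / ε)) :=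
    Real.one_le_sqrt.2 (by nlinarith)
  have hs : √(2 * (truncation t ε : ℝ) * Real.log (48 / ε))
      ≤ 15 * √(1 + t) * Real.log (2 / ε) := by
    refine Real.sqrt_le_iff.2 ⟨by positivity, ?_⟩
    rw [mul_pow, mul_pow, Real.sq_sqrt (by positivity)]
    calc 2 * (truncation t ε : ℝ) * Real.log (48 / ε)
        ≤ 2 * (18 * (1 + t) * Real.log (2 / ε)) * (6 * Real.log (2 / ε)) := by
          gcongr
          exact truncation_le ht hε hε1
      -- `2 · 18 · 6 = 216 ≤ 15²`.
      _ ≤ 15 ^ 2 * (1 + t) * Real.log (2 / ε) ^ 2 := by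
          have : 0 ≤ (1 + t) * Real.log (2 / ε) ^ 2 := by positivity
          nlinarith
  have hc := Nat.ceil_lt_add_one (Real.sqrt_nonneg (2 * (truncation t ε : ℝ) * Real.log (48 / ε)))
  change (chebTruncation t ε : ℝ) < _ at hc
  linarith

lemma chebTruncation_le_of_one_le (ht : 1 ≤ t) (hε : 0 < ε) (hε1 : ε ≤ 1 / 2) :
    (chebTruncation t ε : ℝ) ≤ 120 * √t * Real.log (1 / ε) := by
  have h := chebTruncation_le (t := t) (by linarith) hε (by linarith)
  have h1 : √(1 + t) ≤ 2 * √t := by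
    refine Real.sqrt_le_iff.2 ⟨by positivity, ?_⟩
    rw [mul_pow, Real.sq_sqrt (by linarith)]
    linarith
  have h2 : Real.log (2 / ε) ≤ 2 * Real.log (1 / ε) := by
    have : Real.log 2 ≤ Real.log (1 / ε) :=
      Real.log_le_log (by norm_num) ((le_div_iff₀ hε).2 (by linarith))
    rw [show (2 / ε : ℝ) = 2 * (1 / ε) by ring, Real.log_mul (by norm_num) (by positivity)]
    linarith
  have h3 := (log_div_pos (b := 2) (by norm_num) hε (by linarith : ε < 1)).le
  calc _ ≤ _ := h
    _ ≤ 30 * (2 * √t) * (2 * Real.log (1 / ε)) := by gcongr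
    _ = _ := by ring

end Parameters

/-! ### The averaged block and the loss in success probability -/

section Approximation

variable {ι : Type*} [Fintype ι] [DecidableEq ι] {a : ℕ}

/-- Error budget: `ε/12` for the Chebyshev truncation, `dδ ≤ ε/12` for replacing `A` by `H` in
powers up to `d`, and `ε/6` for the Poisson truncation. -/
lemma norm_sum_expQueries_sub_exp_le {t ε δ : ℝ} {H : Matrix ι ι ℂ}
    {U : Matrix (Qubits a × ι) (Qubits a × ι) ℂ} (ht : 0 < t) (hε : 0 < ε) (hε1 : ε < 1)
    (hH : ‖H‖ ≤ 1) (hU : IsBlockEncoding 1 a δ U H) (hUU : U * U = 1)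
    (hδ : δ ≤ ε ^ 2 / (1152 * (truncation t ε : ℝ) * Real.log (48 / ε))) :
    ‖∑ k ∈ Finset.range (chebTruncation t ε + 1),
        (expQueries t (chebTruncation t ε) (truncation t ε) k).toReal •
          topLeftBlock (walk U ^ k)
      - NormedSpace.exp (-(t : ℂ) • (1 - H))‖ ≤ ε / 3 := by
  have hD := chebTruncation_pos (t := t) hε hε1
  have hd := truncation_pos (t := t) hε hε1
  set D := chebTruncation t ε with hDdef
  set d := truncation t ε with hddef
  have hB : ∀ k, ‖topLeftBlock (walk U ^ k)‖ ≤ 1 := fun k =>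
    norm_topLeftBlock_le_one
      (norm_le_one_of_mem_unitaryGroup (pow_mem (walk_mem_unitaryGroup hU.unitary) k))
  have hcheb := isChebyshevSeq_topLeftBlock_walk hUU
  have hA : ‖topLeftBlock U‖ ≤ 1 := by
    rw [← hcheb.one]
    exact hB 1
  have hclose : ‖topLeftBlock U - H‖ ≤ δ := by
    simpa [norm_sub_rev] using hU.close
  set p : ℕ → ℝ := fun j => (pick d (poissonCoeff t) (poissonCoeff_zero_pos t) j).toReal with hp
  have hp0 : ∀ j, 0 ≤ p j := fun j => ENNReal.toReal_nonneg
  have hp1 : ∑ j ∈ Finset.range (d + 1), p j = 1 :=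
    sum_toReal_eq_one _ _ (pick_eq_zero _ _ _)
  rw [sum_expQueries_smul t hD]
  set S : ℕ → Matrix ι ι ℂ := fun j =>
    ∑ l ∈ Finset.range ((if Even j then D / 2 else (D - 1) / 2) + 1),
      (pick (if Even j then D / 2 else (D - 1) / 2) (powCoeff j)
        (powCoeff_zero_pos j) l).toReal • topLeftBlock (walk U ^ chebDegree j l) with hS
  have h1 : ∀ j ∈ Finset.range (d + 1), ‖S j - H ^ j‖ ≤ ε / 12 + d * δ := by
    intro j hj
    have hj : j ≤ d := Nat.lt_succ_iff.1 (Finset.mem_range.1 hj)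
    -- Twice the tail mass, which is itself at most `2 · ε/48`.
    have e1 : ‖S j - topLeftBlock U ^ j‖ ≤ ε / 12 := by
      refine (norm_sum_pick_smul_sub_le (powCoeff_zero_pos j) (powCoeff_nonneg j)
        (hasSum_powCoeff j) (fun l => hB _) (hcheb.hasSum_pow j) _).trans ?_
      have htail := powCoeff_tail_le hj hd (D := D)
        (m := if Even j then D / 2 else (D - 1) / 2) fun l hl => by
          by_contra hlt
          exact absurd ((chebDegree_le_iff hD).1 (not_le.1 hlt).le) (not_le.2 hl)
      have := exp_neg_chebTruncation_sq_le (t := t) hε hε1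
      linarith
    have e2 : ‖topLeftBlock U ^ j - H ^ j‖ ≤ d * δ :=
      (norm_pow_sub_pow_le hA hH j).trans (by gcongr)
    calc _ ≤ _ := norm_sub_le_norm_sub_add_norm_sub _ (topLeftBlock U ^ j) _
      _ ≤ _ := add_le_add e1 e2
  have h2 : ‖∑ j ∈ Finset.range (d + 1), p j • S j - ∑ j ∈ Finset.range (d + 1), p j • H ^ j‖
      ≤ ε / 12 + d * δ := by
    rw [← Finset.sum_sub_distrib]
    calc _ ≤ ∑ j ∈ Finset.range (d + 1), p j * (ε / 12 + d * δ) := by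
          refine norm_sum_le_of_le _ fun j hj => ?_
          rw [← smul_sub, norm_smul, Real.norm_of_nonneg (hp0 j)]
          exact mul_le_mul_of_nonneg_left (h1 j hj) (hp0 j)
      _ = _ := by rw [← Finset.sum_mul, hp1, one_mul]
  have h3 : ‖∑ j ∈ Finset.range (d + 1), p j • H ^ j - NormedSpace.exp (-(t : ℂ) • (1 - H))‖
      ≤ ε / 6 := by
    refine (norm_sum_pick_smul_sub_le (poissonCoeff_zero_pos t) (poissonCoeff_nonneg ht.le)
      (hasSum_poissonCoeff t) (fun j => norm_pow_le_one hH j)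
      (hasSum_poissonCoeff_smul_pow t H) d).trans ?_
    have := poissonCoeff_tail_le ht.le (mul_exp_two_le_truncation (t := t) (ε := ε))
    have := exp_neg_truncation_le (t := t) hε
    linarith
  -- There is slack here: after cancelling `d` only `ε ≤ 96 ln(48/ε)` is needed.
  have h4 : (d : ℝ) * δ ≤ ε / 12 := by
    have hd' : (0 : ℝ) < d := Nat.cast_pos.2 hd
    have hL : Real.log 2 ≤ Real.log (48 / ε) :=
      Real.log_le_log (by norm_num) ((le_div_iff₀ hε).2 (by linarith))
    have hl2 := Real.log_two_gt_d9
    calc (d : ℝ) * δ ≤ d * (ε ^ 2 / (1152 * (d : ℝ) * Real.log (48 / ε))) := by gcongr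
      _ = ε ^ 2 / (1152 * Real.log (48 / ε)) := by
        have : Real.log (48 / ε) ≠ 0 := by linarith
        field_simp
      _ ≤ ε / 12 := by
        rw [div_le_iff₀ (by linarith)]
        nlinarith
  calc _ ≤ _ := norm_sub_le_norm_sub_add_norm_sub _ (∑ j ∈ Finset.range (d + 1), p j • H ^ j) _
    _ ≤ (ε / 12 + d * δ) + ε / 6 := add_le_add h2 h3
    _ ≤ ε / 3 := by linarith

set_option linter.unusedSectionVars false in
lemma isStarProjection_one_kronecker {P : Matrix ι ι ℂ} (hP : IsStarProjection P) :
    IsStarProjection ((1 : Matrix (Qubits a) (Qubits a) ℂ) ⊗ₖ P) := by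
  have h1 : Pᴴ = P := hP.isSelfAdjoint
  have h2 : P * P = P := hP.isIdempotentElem
  refine ⟨?_, ?_⟩
  · rw [IsIdempotentElem, ← Matrix.mul_kronecker_mul, one_mul, h2]
  · rw [IsSelfAdjoint, Matrix.star_eq_conjTranspose, Matrix.conjTranspose_kronecker,
      Matrix.conjTranspose_one, h1]

lemma conjTranspose_zeroIsometry_mul_kronecker (P : Matrix ι ι ℂ) :
    (zeroIsometry a ι)ᴴ * ((1 : Matrix (Qubits a) (Qubits a) ℂ) ⊗ₖ P)
      = P * (zeroIsometry a ι)ᴴ := by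
  rw [conjTranspose_zeroIsometry_mul]
  ext i ⟨x, j⟩
  by_cases hx : x = 0 <;>
    simp [zeroIsometry, Matrix.mul_apply, Matrix.one_apply, hx, eq_comm]

/-- `W†` is a contraction that intertwines `I ⊗ P` with `P`, so the branch with ancillas in `|0̄⟩`
bounds the unconditioned outcome from below. -/
lemma norm_mulVec_topLeftBlock_le {P : Matrix ι ι ℂ}
    (M : Matrix (Qubits a × ι) (Qubits a × ι) ℂ) (ψ : ι → ℂ) :
    ‖WithLp.toLp 2 (P *ᵥ (topLeftBlock M *ᵥ ψ))‖
      ≤ ‖WithLp.toLp 2 (((1 : Matrix (Qubits a) (Qubits a) ℂ) ⊗ₖ P) *ᵥ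
          (M *ᵥ withZero a ψ))‖ := by
  have hW : ‖(zeroIsometry a ι)ᴴ‖ ≤ 1 := by
    rw [Matrix.l2_opNorm_conjTranspose]
    exact norm_le_one_of_conjTranspose_mul_self conjTranspose_zeroIsometry_mul_self
  have e : P *ᵥ (topLeftBlock M *ᵥ ψ) = (zeroIsometry a ι)ᴴ *ᵥ
      (((1 : Matrix (Qubits a) (Qubits a) ℂ) ⊗ₖ P) *ᵥ (M *ᵥ withZero a ψ)) := by
    rw [withZero_eq, topLeftBlock_eq]
    simp only [Matrix.mulVec_mulVec]
    rw [← Matrix.mul_assoc _ _ (M * _), conjTranspose_zeroIsometry_mul_kronecker]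
    simp only [Matrix.mul_assoc]
  rw [e]
  exact norm_toLp_mulVec_le hW _

lemma norm_sq_sum_smul_le {E : Type*} [NormedAddCommGroup E] [NormedSpace ℝ E] {s : Finset ℕ}
    {q : ℕ → ℝ} (hq : ∀ k ∈ s, 0 ≤ q k) (hq1 : ∑ k ∈ s, q k = 1) (x : ℕ → E) :
    ‖∑ k ∈ s, q k • x k‖ ^ 2 ≤ ∑ k ∈ s, q k * ‖x k‖ ^ 2 := by
  have hconv : ConvexOn ℝ Set.univ fun x : E => ‖x‖ ^ 2 :=
    (convexOn_norm convex_univ).pow (fun _ _ => norm_nonneg _) 2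
  simpa using hconv.map_sum_le hq hq1 (fun _ _ => Set.mem_univ _)

/-- `(‖x‖ + ε/3)² ≤ ‖x‖² + 2ε/3 + ε²/9 ≤ ‖x‖² + ε`, which is where the target accuracy `ε/3` comes
from. -/
lemma norm_sq_sub_le {E : Type*} [NormedAddCommGroup E] {x y : E} {ε : ℝ} (hε1 : ε < 1)
    (hx : ‖x‖ ≤ 1) (h : ‖x - y‖ ≤ ε / 3) : ‖y‖ ^ 2 - ε ≤ ‖x‖ ^ 2 := by
  have h1 : ‖y‖ ≤ ‖x‖ + ‖x - y‖ := by
    rw [norm_sub_rev]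
    exact norm_le_norm_add_norm_sub' y x
  nlinarith [norm_nonneg x, norm_nonneg y, norm_nonneg (x - y)]

lemma posSemidef_pureState {κ : Type*} [Finite κ] (φ : κ → ℂ) : (pureState φ).PosSemidef :=
  Matrix.posSemidef_vecMulVec_self_star φ

end Approximation

end AncillaFree

/-! ### Assembly of the success bound and the query count -/

theorem mainTheorem10 :
    ∃ C : ℝ, 0 < C ∧
      ∀ (ι : Type*) [Fintype ι] [DecidableEq ι] (a : ℕ) (t ε δ : ℝ)
        (H : Matrix ι ι ℂ)
        (U : Matrix (AncillaFree.Qubits a × ι) (AncillaFree.Qubits a × ι) ℂ)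
        (P : Matrix ι ι ℂ) (ψ : ι → ℂ),
        0 < t → 0 < ε → ε < 1 →
        H.IsHermitian → ‖H‖ = 1 →
        AncillaFree.IsBlockEncoding 1 a δ U H → U * U = 1 →
        δ ≤ ε ^ 2 / (1152 * (AncillaFree.truncation t ε : ℝ) * Real.log (48 / ε)) →
        IsStarProjection P →
        star ψ ⬝ᵥ ψ = 1 →
        let alg : PMF (AncillaFree.Run (AncillaFree.Qubits a × ι)) :=
          AncillaFree.expHam t (AncillaFree.chebTruncation t ε) (AncillaFree.truncation t ε)
            (AncillaFree.walk U) (AncillaFree.withZero a ψ)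
        let ρbar := AncillaFree.averageState alg
        let E : Matrix ι ι ℂ := NormedSpace.exp (-(t : ℂ) • (1 - H))
        (ρbar.PosSemidef ∧ ρbar.trace = 1) ∧
        (P * (E * AncillaFree.pureState ψ * E)).trace.re - ε
          ≤ (((1 : Matrix (AncillaFree.Qubits a) (AncillaFree.Qubits a) ℂ) ⊗ₖ P)
              * ρbar).trace.re ∧
        ∀ r ∈ alg.support,
          (r.queries : ℝ) ≤ C * √(1 + t) * Real.log (2 / ε) ∧
          (1 ≤ t → ε ≤ 1 / 2 → (r.queries : ℝ) ≤ C * √t * Real.log (1 / ε)) := by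
  -- The regime `t ≥ 1`, `ε ≤ 1/2` dictates 120, via `√(1+t) ≤ 2√t` and `ln(2/ε) ≤ 2 ln(1/ε)`; the
  -- general bound needs only 30.
  refine ⟨120, by norm_num, ?_⟩
  intro ι _ _ a t ε δ H U P ψ ht hε hε1 hHerm hH hU hUU hδ hP hψ alg ρbar E
  have hD := AncillaFree.chebTruncation_pos (t := t) hε hε1
  have happrox := AncillaFree.norm_sum_expQueries_sub_exp_le ht hε hε1 hH.le hU hUU hδ
  set D := AncillaFree.chebTruncation t ε with hDdef
  set d := AncillaFree.truncation t ε with hddef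
  set V := AncillaFree.walk U with hV
  set φ := AncillaFree.withZero a ψ with hφ
  set q : ℕ → ℝ := fun k => (AncillaFree.expQueries t D d k).toReal with hqdef
  have hq : ∀ k ∈ Finset.range (D + 1), 0 ≤ q k := fun k _ => ENNReal.toReal_nonneg
  have hq1 : ∑ k ∈ Finset.range (D + 1), q k = 1 :=
    AncillaFree.sum_toReal_eq_one _ _ (AncillaFree.expQueries_eq_zero hD)
  have hρ : ρbar = ∑ k ∈ Finset.range (D + 1), q k • AncillaFree.pureState ((V ^ k) *ᵥ φ) :=
    AncillaFree.averageState_expHam t hD V φ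
  have hVk : ∀ k, V ^ k ∈ Matrix.unitaryGroup _ ℂ := fun k =>
    pow_mem (AncillaFree.walk_mem_unitaryGroup hU.unitary) k
  have hnormψ : ‖WithLp.toLp 2 ψ‖ ≤ 1 := by
    have h := AncillaFree.star_dotProduct_self_eq ψ
    rw [hψ] at h
    have h : ‖WithLp.toLp 2 ψ‖ ^ 2 = 1 := by exact_mod_cast h.symm
    nlinarith [norm_nonneg (WithLp.toLp 2 ψ)]
  refine ⟨⟨?_, ?_⟩, ?_, ?_⟩
  · rw [hρ]
    exact Matrix.posSemidef_sum _ fun k hk =>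
      (AncillaFree.posSemidef_pureState _).smul (hq k hk)
  · have htr : ∀ k, (AncillaFree.pureState ((V ^ k) *ᵥ φ)).trace = 1 := by
      intro k
      rw [AncillaFree.trace_pureState, Matrix.star_mulVec, ← Matrix.dotProduct_mulVec,
        Matrix.mulVec_mulVec, ← Matrix.star_eq_conjTranspose,
        Matrix.mem_unitaryGroup_iff'.1 (hVk k), Matrix.one_mulVec, hφ,
        AncillaFree.withZero_eq, Matrix.star_mulVec, ← Matrix.dotProduct_mulVec,
        Matrix.mulVec_mulVec, AncillaFree.conjTranspose_zeroIsometry_mul_self,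
        Matrix.one_mulVec, hψ]
    rw [hρ, Matrix.trace_sum]
    simp_rw [Matrix.trace_smul, htr]
    rw [← Finset.sum_smul, hq1, one_smul]
  · set Q := ((1 : Matrix (AncillaFree.Qubits a) (AncillaFree.Qubits a) ℂ) ⊗ₖ P) with hQdef
    have hQ : IsStarProjection Q := AncillaFree.isStarProjection_one_kronecker hP
    set S := ∑ k ∈ Finset.range (D + 1), q k • AncillaFree.topLeftBlock (V ^ k) with hS
    have hE : Eᴴ = E := by
      refine Matrix.IsHermitian.exp ?_
      rw [Matrix.IsHermitian, Matrix.conjTranspose_smul, Matrix.conjTranspose_sub,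
        Matrix.conjTranspose_one, hHerm.eq]
      simp
    have hleft : (P * (E * AncillaFree.pureState ψ * E)).trace.re
        = ‖WithLp.toLp 2 (P *ᵥ (E *ᵥ ψ))‖ ^ 2 := by
      have h := AncillaFree.mul_pureState_mul (Q := E) ψ
      rw [hE] at h
      rw [h, AncillaFree.trace_projection_mul_pureState hP]
    have hright : (Q * ρbar).trace.re
        = ∑ k ∈ Finset.range (D + 1), q k * ‖WithLp.toLp 2 (Q *ᵥ ((V ^ k) *ᵥ φ))‖ ^ 2 := by
      rw [hρ, Finset.mul_sum, Matrix.trace_sum, Complex.re_sum]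
      refine Finset.sum_congr rfl fun k _ => ?_
      rw [Matrix.mul_smul, Matrix.trace_smul, Complex.real_smul, Complex.re_ofReal_mul,
        AncillaFree.trace_projection_mul_pureState hQ]
    have hSvec : WithLp.toLp 2 (P *ᵥ (S *ᵥ ψ)) = ∑ k ∈ Finset.range (D + 1),
        q k • WithLp.toLp 2 (P *ᵥ (AncillaFree.topLeftBlock (V ^ k) *ᵥ ψ)) := by
      rw [hS, Matrix.sum_mulVec, Matrix.mulVec_sum, WithLp.toLp_sum]
      refine Finset.sum_congr rfl fun k _ => ?_
      rw [Matrix.smul_mulVec, Matrix.mulVec_smul, WithLp.toLp_smul]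
    -- Jensen for the squared norm over the number of queries, followed termwise by the contraction
    -- onto `|0̄⟩`.
    have hjensen : ‖WithLp.toLp 2 (P *ᵥ (S *ᵥ ψ))‖ ^ 2 ≤ (Q * ρbar).trace.re := by
      rw [hSvec, hright]
      refine (AncillaFree.norm_sq_sum_smul_le hq hq1 _).trans
        (Finset.sum_le_sum fun k hk => mul_le_mul_of_nonneg_left ?_ (hq k hk))
      exact pow_le_pow_left₀ (norm_nonneg _) (AncillaFree.norm_mulVec_topLeftBlock_le _ _) 2
    -- A convex combination of contractions; this supplies the hypothesis `‖x‖ ≤ 1` of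
    -- `norm_sq_sub_le`.
    have hSnorm : ‖S‖ ≤ 1 := by
      rw [← hq1]
      refine norm_sum_le_of_le _ fun k hk => ?_
      rw [norm_smul, Real.norm_of_nonneg (hq k hk)]
      exact mul_le_of_le_one_right (hq k hk) (AncillaFree.norm_topLeftBlock_le_one
        (AncillaFree.norm_le_one_of_mem_unitaryGroup (hVk k)))
    have hPnorm := AncillaFree.IsStarProjection.norm_le_one hP
    have hx : ‖WithLp.toLp 2 (P *ᵥ (S *ᵥ ψ))‖ ≤ 1 :=
      ((AncillaFree.norm_toLp_mulVec_le hPnorm _).trans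
        (AncillaFree.norm_toLp_mulVec_le hSnorm _)).trans hnormψ
    have hdiff : ‖WithLp.toLp 2 (P *ᵥ (S *ᵥ ψ)) - WithLp.toLp 2 (P *ᵥ (E *ᵥ ψ))‖ ≤ ε / 3 := by
      rw [← WithLp.toLp_sub, ← Matrix.mulVec_sub, ← Matrix.sub_mulVec]
      refine (AncillaFree.norm_toLp_mulVec_le hPnorm _).trans ?_
      refine (Matrix.l2_opNorm_mulVec (S - E) (WithLp.toLp 2 ψ)).trans ?_
      exact (mul_le_of_le_one_right (norm_nonneg _) hnormψ).trans happrox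
    rw [hleft]
    exact (AncillaFree.norm_sq_sub_le hε1 hx hdiff).trans hjensen
  · intro r hr
    have hr : (r.queries : ℝ) ≤ D :=
      Nat.cast_le.2 (AncillaFree.queries_le_of_mem_support_expHam hD V φ hr)
    refine ⟨?_, fun ht1 hε2 => hr.trans (AncillaFree.chebTruncation_le_of_one_le ht1 hε hε2)⟩
    refine (hr.trans (AncillaFree.chebTruncation_le ht hε hε1)).trans ?_
    have := (AncillaFree.log_div_pos (b := 2) (by norm_num) hε hε1).le
    gcongr
    norm_num
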